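/- Let $d\ge 1$, let $\Omega\subset\mathbb{R}^d$ be a bounded open set, let $T>0$, and let $a\in C(\overline\Omega)$ be a scalar function with $0<\alpha_{\min}\le a\le\alpha_{\max}$ on $\overline\Omega$. Let $\|\cdot\|$ and $\langle\cdot,\cdot\rangle$ be the norm and inner product of $L^2(\Omega)$, let $H^1_0(\Omega)$ be the closure of $C_c^\infty(\Omega)$ in $H^1(\Omega)$, let $H^{-1}(\Omega)$ be its dual, and put $a(z,v)=\int_\Omega a\nabla z\cdot\nabla v\,dx$ for $z,v\in H^1_0(\Omega)$. Let $f\in L^2(0,T;L^2(\Omega))$, $u_0\in H^1_0(\Omega)$ and $u_1\in L^2(\Omega)$. For a function $v$ on $(0,T)$ with time derivative in $L^1(0,T;X)$, $X$ a Banach space, $v(0)$ denotes the value at $0$ of its continuous representative with values in $X$. Let $u\in L^2(0,T;H^1_0(\Omega))$ with $u_t\in L^2(0,T;L^2(\Omega))$ and $u_{tt}\in L^2(0,T;H^{-1}(\Omega))$ be a weak solution of $u_{tt}-\nabla\cdot(a\nabla u)=f$ in $(0,T)\times\Omega$, $u=0$ on $(0,T)\times\partial\Omega$, $u(0)=u_0$,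 $u_t(0)=u_1$; that is, for a.e. $t\in(0,T)$, $$\langle u_{tt}(t),v\rangle+a(u(t),v)=\langle f(t),v\rangle\qquad\text{for all }v\in H^1_0(\Omega).$$ Let $V_h\subset H^1_0(\Omega)$ be a finite-dimensional subspace (for example a finite element space), and let $U\in L^2(0,T;V_h)$, with $U_t,U_{tt}\in L^1(0,T;V_h)$, satisfy $$\langle U_{tt},V\rangle+a(U,V)=\langle f,V\rangle\quad\text{a.e. in }(0,T),\qquad\text{for all }V\in L^2(0,T;V_h).$$ Let $\Pi:L^2(\Omega)\to V_h$ be the $L^2(\Omega)$-orthogonal projection, let $A:V_h\to V_h$ be given by $\langle Aq,\chi\rangle=a(q,\chi)$ for all $q,\chi\in V_h$, and let $w$ be the elliptic reconstruction of $U$, that is, the function $w:(0,T)\to H^1_0(\Omega)$ such that for a.e. $t\in(0,T)$ $$a(w(t),v)=\langle AU(t)-\Pi f(t)+f(t),v\rangle\qquad\text{for all }v\in H^1_0(\Omega).$$ Put $\epsilon=w-U$ and assume that $\epsilon$ has a time derivative $\epsilon_t\in L^1(0,T;L^2(\Omega))$. Then the Poincaré–Friedrichs inequality $\|v\|^2\le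 C_\Omega\|\nabla v\|^2$, $v\in H^1_0(\Omega)$, holds for some constant $C_\Omega$, and for every constant $C_\Omega$ for which it holds, $$\|U-u\|_{L^\infty(0,T;L^2(\Omega))}\le\|\epsilon\|_{L^\infty(0,T;L^2(\Omega))}+\sqrt2\,\bigl(\|u_0-U(0)\|+\|\epsilon(0)\|\bigr)+2\int_0^T\|\epsilon_t\|\,dt+C_{a,T}\,\|u_1-U_t(0)\|,$$ where $C_{a,T}=\min\bigl\{2T,\sqrt{2C_\Omega/\alpha_{\min}}\bigr\}$. -/

import Mathlib

open MeasureTheory Set TopologicalSpace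
open scoped ContDiff ENNReal InnerProductSpace Gradient

noncomputable section

namespace WaveFEM

variable {d : ℕ}

/-! ### Function spaces on an open set `Ω ⊆ ℝᵈ` -/

/-- The Lebesgue space `L²(Ω)` of real-valued functions. -/
abbrev L2 (Ω : Opens (EuclideanSpace ℝ (Fin d))) : Type :=
  Lp ℝ 2 (volume.restrict (Ω : Set (EuclideanSpace ℝ (Fin d))))

/-- The Lebesgue space `L²(Ω; ℝᵈ)` of vector fields. -/
abbrev L2Vec (Ω : Opens (EuclideanSpace ℝ (Fin d))) : Type :=
  Lp (EuclideanSpace ℝ (Fin d)) 2 (volume.restrict (Ω : Set (EuclideanSpace ℝ (Fin d))))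

/-- `φ ∈ C_c^∞(Ω)`. -/
structure IsTestFunction (Ω : Opens (EuclideanSpace ℝ (Fin d)))
    (φ : EuclideanSpace ℝ (Fin d) → ℝ) : Prop where
  contDiff : ContDiff ℝ ∞ φ
  hasCompactSupport : HasCompactSupport φ
  tsupport_subset : tsupport φ ⊆ (Ω : Set (EuclideanSpace ℝ (Fin d)))

/-- `G` is the weak (distributional) gradient of `v` in `Ω`: for every direction `y` and every
`φ ∈ C_c^∞(Ω)`, `∫_Ω v ∂_y φ = -∫_Ω (G · y) φ`. -/
def HasWeakGradient (Ω : Opens (EuclideanSpace ℝ (Fin d))) (v : L2 Ω) (G : L2Vec Ω) : Prop :=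
  ∀ φ : EuclideanSpace ℝ (Fin d) → ℝ, IsTestFunction Ω φ → ∀ y : EuclideanSpace ℝ (Fin d),
    ∫ x in (Ω : Set (EuclideanSpace ℝ (Fin d))), v x * fderiv ℝ φ x y =
      -∫ x in (Ω : Set (EuclideanSpace ℝ (Fin d))), ⟪G x, y⟫_ℝ * φ x

/-- The pairs `(φ, ∇φ)`, `φ ∈ C_c^∞(Ω)`, inside `L²(Ω) × L²(Ω; ℝᵈ)`, the latter with the Hilbert
norm `‖(v, G)‖² = ‖v‖² + ‖G‖²`, which restricts to the `H¹(Ω)`-norm on pairs `(v, ∇v)`. -/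
def testGraph (Ω : Opens (EuclideanSpace ℝ (Fin d))) :
    Submodule ℝ (WithLp 2 (L2 Ω × L2Vec Ω)) where
  carrier := {p | ∃ φ : EuclideanSpace ℝ (Fin d) → ℝ, IsTestFunction Ω φ ∧
    p.fst =ᵐ[volume.restrict (Ω : Set (EuclideanSpace ℝ (Fin d)))] φ ∧
    p.snd =ᵐ[volume.restrict (Ω : Set (EuclideanSpace ℝ (Fin d)))] ∇ φ}
  add_mem' := by
    rintro p q ⟨φ, hφ, hp1, hp2⟩ ⟨ψ, hψ, hq1, hq2⟩
    refine ⟨φ + ψ, ⟨hφ.1.add hψ.1, hφ.2.add hψ.2, ?_⟩, ?_, ?_⟩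
    · exact (tsupport_add φ ψ).trans (union_subset hφ.3 hψ.3)
    · rw [WithLp.add_fst]
      exact (Lp.coeFn_add _ _).trans (hp1.add hq1)
    · rw [WithLp.add_snd]
      refine (Lp.coeFn_add _ _).trans ((hp2.add hq2).trans (Filter.Eventually.of_forall ?_))
      intro x
      have h1 := (hφ.1.differentiable (by simp)) x
      have h2 := (hψ.1.differentiable (by simp)) x
      simp only [gradient, Pi.add_apply]
      rw [fderiv_add h1 h2, map_add]
  zero_mem' := by
    refine ⟨0, ⟨contDiff_const, HasCompactSupport.zero, by simp⟩, ?_, ?_⟩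
    · exact Lp.coeFn_zero _ _ _
    · refine (Lp.coeFn_zero _ _ _).trans (Filter.Eventually.of_forall ?_)
      intro x
      have : (0 : EuclideanSpace ℝ (Fin d) → ℝ) = fun _ => 0 := rfl
      simp [this, gradient]
  smul_mem' := by
    rintro c p ⟨φ, hφ, hp1, hp2⟩
    refine ⟨c • φ, ⟨hφ.1.const_smul c, hφ.2.smul_left (f := fun _ => c), ?_⟩, ?_, ?_⟩
    · exact (tsupport_smul_subset_right (fun _ => c) φ).trans hφ.3
    · rw [WithLp.smul_fst]
      exact (Lp.coeFn_smul _ _).trans (hp1.const_smul c)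
    · rw [WithLp.smul_snd]
      refine (Lp.coeFn_smul _ _).trans ((hp2.const_smul c).trans (Filter.Eventually.of_forall ?_))
      intro x
      have h1 := (hφ.1.differentiable (by simp)) x
      simp only [gradient, Pi.smul_apply]
      rw [fderiv_const_smul h1, map_smul]

/-- `H¹₀(Ω)`: the closure of `C_c^∞(Ω)` in the `H¹(Ω)`-norm, a function `v` being represented by
the pair `(v, ∇v)`. -/
def H10Submodule (Ω : Opens (EuclideanSpace ℝ (Fin d))) :
    Submodule ℝ (WithLp 2 (L2 Ω × L2Vec Ω)) :=
  (testGraph Ω).topologicalClosure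

/-- The Hilbert space `H¹₀(Ω)`, with the `H¹(Ω)` inner product. -/
abbrev H10 (Ω : Opens (EuclideanSpace ℝ (Fin d))) : Type := H10Submodule Ω

/-- The embedding `H¹₀(Ω) → L²(Ω)`. -/
def toL2 (Ω : Opens (EuclideanSpace ℝ (Fin d))) : H10 Ω →L[ℝ] L2 Ω :=
  (WithLp.fstL 2 ℝ (L2 Ω) (L2Vec Ω)).comp (H10Submodule Ω).subtypeL

/-- The (weak) gradient `H¹₀(Ω) → L²(Ω; ℝᵈ)`. -/
def grad (Ω : Opens (EuclideanSpace ℝ (Fin d))) : H10 Ω →L[ℝ] L2Vec Ω :=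
  (WithLp.sndL 2 ℝ (L2 Ω) (L2Vec Ω)).comp (H10Submodule Ω).subtypeL

/-! ### Functions in `H¹₀(Ω)` are determined by their values -/

theorem IsTestFunction.memLp {Ω : Opens (EuclideanSpace ℝ (Fin d))}
    {φ : EuclideanSpace ℝ (Fin d) → ℝ} (hφ : IsTestFunction Ω φ) :
    MemLp φ 2 (volume.restrict (Ω : Set (EuclideanSpace ℝ (Fin d)))) :=
  (hφ.1.continuous.memLp_of_hasCompactSupport hφ.2).restrict _

theorem IsTestFunction.memLp_fderiv {Ω : Opens (EuclideanSpace ℝ (Fin d))}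
    {φ : EuclideanSpace ℝ (Fin d) → ℝ} (hφ : IsTestFunction Ω φ) (y : EuclideanSpace ℝ (Fin d)) :
    MemLp (fun x => fderiv ℝ φ x y) 2
      (volume.restrict (Ω : Set (EuclideanSpace ℝ (Fin d)))) := by
  have hc : Continuous fun x => fderiv ℝ φ x y :=
    (hφ.1.continuous_fderiv (by simp)).clm_apply continuous_const
  exact (hc.memLp_of_hasCompactSupport (hφ.2.fderiv_apply (𝕜 := ℝ) y)).restrict _

theorem isClosed_hasWeakGradient (Ω : Opens (EuclideanSpace ℝ (Fin d))) :
    IsClosed {p : WithLp 2 (L2 Ω × L2Vec Ω) | HasWeakGradient Ω p.fst p.snd} := by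
  simp only [HasWeakGradient, ofPred_forall]
  refine isClosed_iInter fun φ => isClosed_iInter fun hφ => isClosed_iInter fun y => ?_
  have m1 := hφ.memLp_fderiv y
  have m2 : MemLp (fun x => φ x • y) 2
      (volume.restrict (Ω : Set (EuclideanSpace ℝ (Fin d)))) := by
    have hc : Continuous fun x => φ x • y := hφ.1.continuous.smul continuous_const
    exact (hc.memLp_of_hasCompactSupport (hφ.2.smul_right (f' := fun _ => y))).restrict _
  have e1 : ∀ v : L2 Ω, ∫ x in (Ω : Set (EuclideanSpace ℝ (Fin d))), v x * fderiv ℝ φ x y =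
      ⟪m1.toLp, v⟫_ℝ := by
    intro v
    rw [L2.inner_def]
    refine integral_congr_ae ?_
    filter_upwards [m1.coeFn_toLp] with x hx
    rw [hx]
    simp
  have e2 : ∀ G : L2Vec Ω, ∫ x in (Ω : Set (EuclideanSpace ℝ (Fin d))), ⟪G x, y⟫_ℝ * φ x =
      ⟪m2.toLp, G⟫_ℝ := by
    intro G
    rw [L2.inner_def]
    refine integral_congr_ae ?_
    filter_upwards [m2.coeFn_toLp] with x hx
    rw [hx, real_inner_smul_left, real_inner_comm, mul_comm]
  simp only [e1, e2]
  refine isClosed_eq ?_ ?_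
  · exact continuous_const.inner (WithLp.fstL 2 ℝ (L2 Ω) (L2Vec Ω)).continuous
  · exact (continuous_const.inner (WithLp.sndL 2 ℝ (L2 Ω) (L2Vec Ω)).continuous).neg

/-- `grad v` is the weak gradient of `v ∈ H¹₀(Ω)`. -/
theorem hasWeakGradient_toL2_grad (Ω : Opens (EuclideanSpace ℝ (Fin d))) (v : H10 Ω) :
    HasWeakGradient Ω (toL2 Ω v) (grad Ω v) := by
  have key : closure (testGraph Ω : Set (WithLp 2 (L2 Ω × L2Vec Ω))) ⊆
      {p | HasWeakGradient Ω p.fst p.snd} := by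
    refine closure_minimal ?_ (isClosed_hasWeakGradient Ω)
    rintro p ⟨ψ, hψ, hp1, hp2⟩ φ hφ y
    have hψd : Differentiable ℝ ψ := hψ.1.differentiable (by simp)
    have hφd : Differentiable ℝ φ := hφ.1.differentiable (by simp)
    have c1 : Continuous fun x => fderiv ℝ φ x y :=
      (hφ.1.continuous_fderiv (by simp)).clm_apply continuous_const
    have c2 : Continuous fun x => fderiv ℝ ψ x y :=
      (hψ.1.continuous_fderiv (by simp)).clm_apply continuous_const
    have l1 : ∫ x in (Ω : Set (EuclideanSpace ℝ (Fin d))), p.fst x * fderiv ℝ φ x y =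
        ∫ x, ψ x * fderiv ℝ φ x y := by
      rw [← setIntegral_eq_integral_of_forall_compl_eq_zero
        (s := (Ω : Set (EuclideanSpace ℝ (Fin d)))) (f := fun x => ψ x * fderiv ℝ φ x y)]
      · refine integral_congr_ae ?_
        filter_upwards [hp1] with x hx
        rw [hx]
      · intro x hx
        have : x ∉ tsupport ψ := fun h => hx (hψ.3 h)
        rw [image_eq_zero_of_notMem_tsupport this, zero_mul]
    have l2 : ∫ x in (Ω : Set (EuclideanSpace ℝ (Fin d))), ⟪p.snd x, y⟫_ℝ * φ x =
        ∫ x, fderiv ℝ ψ x y * φ x := by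
      rw [← setIntegral_eq_integral_of_forall_compl_eq_zero
        (s := (Ω : Set (EuclideanSpace ℝ (Fin d)))) (f := fun x => fderiv ℝ ψ x y * φ x)]
      · refine integral_congr_ae ?_
        filter_upwards [hp2] with x hx
        rw [hx, inner_gradient_left]
      · intro x hx
        have : x ∉ tsupport φ := fun h => hx (hφ.3 h)
        rw [image_eq_zero_of_notMem_tsupport this, mul_zero]
    rw [l1, l2]
    refine integral_mul_fderiv_eq_neg_fderiv_mul_of_integrable ?_ ?_ ?_
      (fun x _ => hψd x) (fun x _ => hφd x)
    · exact (c2.mul hφ.1.continuous).integrable_of_hasCompactSupport hφ.2.mul_left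
    · exact (hψ.1.continuous.mul c1).integrable_of_hasCompactSupport hψ.2.mul_right
    · exact (hψ.1.continuous.mul hφ.1.continuous).integrable_of_hasCompactSupport hφ.2.mul_left
  exact key v.2

theorem toL2_injective (Ω : Opens (EuclideanSpace ℝ (Fin d))) :
    Function.Injective (toL2 Ω) := by
  rw [injective_iff_map_eq_zero]
  intro v hv
  have hG : grad Ω v = 0 := by
    rw [Lp.eq_zero_iff_ae_eq_zero]
    have hw := hasWeakGradient_toL2_grad Ω v
    rw [hv] at hw
    have hcomp : ∀ y : EuclideanSpace ℝ (Fin d),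
        ∀ᵐ x ∂(volume.restrict (Ω : Set (EuclideanSpace ℝ (Fin d)))), ⟪grad Ω v x, y⟫_ℝ = 0 := by
      intro y
      rw [ae_restrict_iff' Ω.isOpen.measurableSet]
      have hm : MemLp (fun x => ⟪grad Ω v x, y⟫_ℝ) 2
          (volume.restrict (Ω : Set (EuclideanSpace ℝ (Fin d)))) :=
        (Lp.memLp (grad Ω v)).inner_const y
      have hloc : LocallyIntegrableOn (fun x => ⟪grad Ω v x, y⟫_ℝ)
          (Ω : Set (EuclideanSpace ℝ (Fin d))) volume :=
        locallyIntegrableOn_of_locallyIntegrable_restrict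
          (hm.locallyIntegrable (by norm_num))
      refine Ω.isOpen.ae_eq_zero_of_integral_contDiff_smul_eq_zero hloc ?_
      intro φ h1 h2 h3
      have h := hw φ ⟨h1, h2, h3⟩ y
      have hz : ∫ x in (Ω : Set (EuclideanSpace ℝ (Fin d))),
          (0 : L2 Ω) x * fderiv ℝ φ x y = 0 := by
        refine integral_eq_zero_of_ae ?_
        filter_upwards [Lp.coeFn_zero ℝ 2
          (volume.restrict (Ω : Set (EuclideanSpace ℝ (Fin d))))] with x hx
        rw [hx]
        simp
      rw [hz] at h
      rw [← setIntegral_eq_integral_of_forall_compl_eq_zero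
        (s := (Ω : Set (EuclideanSpace ℝ (Fin d)))) (f := fun x => φ x • ⟪grad Ω v x, y⟫_ℝ)]
      · have : ∫ x in (Ω : Set (EuclideanSpace ℝ (Fin d))), ⟪grad Ω v x, y⟫_ℝ * φ x = 0 := by
          linarith
        rw [← this]
        refine integral_congr_ae (Filter.Eventually.of_forall fun x => ?_)
        simp [mul_comm]
      · intro x hx
        have : x ∉ tsupport φ := fun h => hx (h3 h)
        rw [image_eq_zero_of_notMem_tsupport this, zero_smul]
    have hall : ∀ᵐ x ∂(volume.restrict (Ω : Set (EuclideanSpace ℝ (Fin d)))),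
        ∀ i : Fin d, ⟪grad Ω v x, EuclideanSpace.single i (1 : ℝ)⟫_ℝ = 0 :=
      ae_all_iff.2 fun i => hcomp _
    filter_upwards [hall] with x hx
    ext i
    have := hx i
    simpa [EuclideanSpace.inner_single_right] using this
  have h2 : (v : WithLp 2 (L2 Ω × L2Vec Ω)) = 0 := by
    apply WithLp.ofLp_injective
    exact Prod.ext hv hG
  exact Subtype.ext h2

/-! ### The diffusion coefficient and the energy form -/

/-- A scalar diffusion coefficient `a ∈ C(closure Ω)` with `0 < αmin ≤ a ≤ αmax`. -/
structure DiffusionCoeff (Ω : Opens (EuclideanSpace ℝ (Fin d))) where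
  toFun : EuclideanSpace ℝ (Fin d) → ℝ
  αmin : ℝ
  αmax : ℝ
  αmin_pos : 0 < αmin
  continuousOn : ContinuousOn toFun (closure (Ω : Set (EuclideanSpace ℝ (Fin d))))
  lower : ∀ x ∈ closure (Ω : Set (EuclideanSpace ℝ (Fin d))), αmin ≤ toFun x
  upper : ∀ x ∈ closure (Ω : Set (EuclideanSpace ℝ (Fin d))), toFun x ≤ αmax

theorem DiffusionCoeff.integrable {Ω : Opens (EuclideanSpace ℝ (Fin d))} (a : DiffusionCoeff Ω)
    (F G : L2Vec Ω) :
    Integrable (fun x => a.toFun x * ⟪F x, G x⟫_ℝ)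
      (volume.restrict (Ω : Set (EuclideanSpace ℝ (Fin d)))) := by
  refine (L2.integrable_inner (𝕜 := ℝ) F G).bdd_mul (c := a.αmax) ?_ ?_
  · exact (a.continuousOn.mono subset_closure).aestronglyMeasurable Ω.isOpen.measurableSet
  · filter_upwards [ae_restrict_mem Ω.isOpen.measurableSet] with x hx
    have h1 := a.lower x (subset_closure hx)
    have h2 := a.upper x (subset_closure hx)
    rw [Real.norm_eq_abs, abs_of_nonneg (a.αmin_pos.le.trans h1)]
    exact h2

/-- The bilinear form `a(z, v) = ∫_Ω a ∇z · ∇v dx` on `H¹₀(Ω)`. -/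
def energyForm {Ω : Opens (EuclideanSpace ℝ (Fin d))} (a : DiffusionCoeff Ω) :
    LinearMap.BilinForm ℝ (H10 Ω) :=
  LinearMap.mk₂ ℝ
    (fun z v => ∫ x in (Ω : Set (EuclideanSpace ℝ (Fin d))),
      a.toFun x * ⟪grad Ω z x, grad Ω v x⟫_ℝ)
    (by
      intro z z' v
      rw [← integral_add (a.integrable _ _) (a.integrable _ _), map_add]
      refine integral_congr_ae ?_
      filter_upwards [Lp.coeFn_add (grad Ω z) (grad Ω z')] with x hx
      rw [hx, Pi.add_apply, inner_add_left, mul_add])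
    (by
      intro c z v
      rw [smul_eq_mul, ← integral_const_mul, map_smul]
      refine integral_congr_ae ?_
      filter_upwards [Lp.coeFn_smul c (grad Ω z)] with x hx
      rw [hx, Pi.smul_apply, real_inner_smul_left]
      ring)
    (by
      intro z v v'
      rw [← integral_add (a.integrable _ _) (a.integrable _ _), map_add]
      refine integral_congr_ae ?_
      filter_upwards [Lp.coeFn_add (grad Ω v) (grad Ω v')] with x hx
      rw [hx, Pi.add_apply, inner_add_right, mul_add])
    (by
      intro c z v
      rw [smul_eq_mul, ← integral_const_mul, map_smul]
      refine integral_congr_ae ?_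
      filter_upwards [Lp.coeFn_smul c (grad Ω v)] with x hx
      rw [hx, Pi.smul_apply, real_inner_smul_right]
      ring)

/-- `C` is a constant of the Poincaré–Friedrichs inequality on `H¹₀(Ω)`. -/
def IsPoincareConst (Ω : Opens (EuclideanSpace ℝ (Fin d))) (C : ℝ) : Prop :=
  ∀ v : H10 Ω, ‖toL2 Ω v‖ ^ 2 ≤ C * ‖grad Ω v‖ ^ 2

/-! ### The dual space -/

/-- `H⁻¹(Ω)`, the dual of `H¹₀(Ω)` with the dual norm. -/
abbrev Hm1 (Ω : Opens (EuclideanSpace ℝ (Fin d))) : Type := H10 Ω →L[ℝ] ℝ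

/-- The embedding `L²(Ω) → H⁻¹(Ω)`, `g ↦ ⟨g, ·⟩`. -/
def toHm1 (Ω : Opens (EuclideanSpace ℝ (Fin d))) (g : L2 Ω) : Hm1 Ω :=
  (innerSL ℝ g).comp (toL2 Ω)

/-! ### The discrete operators on a finite-dimensional `Vh ⊆ H¹₀(Ω)` -/

/-- The `L²(Ω)` inner product on `Vh`. -/
def massForm {Ω : Opens (EuclideanSpace ℝ (Fin d))} (Vh : Submodule ℝ (H10 Ω)) :
    LinearMap.BilinForm ℝ Vh :=
  LinearMap.mk₂ ℝ (fun z v => ⟪toL2 Ω z, toL2 Ω v⟫_ℝ)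
    (fun z z' v => by simp [inner_add_left])
    (fun c z v => by simp [real_inner_smul_left])
    (fun z v v' => by simp [inner_add_right])
    (fun c z v => by simp [real_inner_smul_right])

theorem massForm_nondegenerate {Ω : Opens (EuclideanSpace ℝ (Fin d))}
    (Vh : Submodule ℝ (H10 Ω)) : (massForm Vh).Nondegenerate := by
  have key : ∀ z : Vh, massForm Vh z z = 0 → z = 0 := by
    intro z hz
    have h0 : toL2 Ω (z : H10 Ω) = 0 := inner_self_eq_zero.1 hz
    have h1 : (z : H10 Ω) = 0 := toL2_injective Ω (by rw [h0, map_zero])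
    exact Subtype.ext h1
  exact ⟨fun z hz => key z (hz z), fun z hz => key z (hz z)⟩

/-- The discrete elliptic operator `A : Vh → Vh`, `⟨A q, χ⟩ = a(q, χ)` for all `χ ∈ Vh`. -/
def discreteElliptic {Ω : Opens (EuclideanSpace ℝ (Fin d))} (a : DiffusionCoeff Ω)
    (Vh : Submodule ℝ (H10 Ω)) [FiniteDimensional ℝ Vh] : Vh →ₗ[ℝ] Vh :=
  ((massForm Vh).toDual (massForm_nondegenerate Vh)).symm.toLinearMap ∘ₗ
    ((energyForm a).restrict Vh)

theorem inner_discreteElliptic {Ω : Opens (EuclideanSpace ℝ (Fin d))} (a : DiffusionCoeff Ω)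
    (Vh : Submodule ℝ (H10 Ω)) [FiniteDimensional ℝ Vh] (q χ : Vh) :
    ⟪toL2 Ω (discreteElliptic a Vh q), toL2 Ω χ⟫_ℝ = energyForm a q χ :=
  LinearMap.BilinForm.apply_toDual_symm_apply (hB := massForm_nondegenerate Vh)
    ((energyForm a).restrict Vh q) χ

/-- The orthogonal `L²(Ω)`-projection onto `Vh`. -/
def projL2 {Ω : Opens (EuclideanSpace ℝ (Fin d))} (Vh : Submodule ℝ (H10 Ω))
    [FiniteDimensional ℝ Vh] : L2 Ω →L[ℝ] L2 Ω :=
  (Vh.map (toL2 Ω).toLinearMap).starProjection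

/-! ### Functions of time -/

/-- Lebesgue measure on the time interval `(0, T)`. -/
abbrev timeMeasure (T : ℝ) : Measure ℝ := volume.restrict (Ioo 0 T)

/-- `v : (0, T) → X` (defined up to null sets) has the time derivative `v' ∈ L¹(0, T; X)` and the
initial value `v0`: the continuous representative of `v` is absolutely continuous, equals `v0` at
time `0`, and `v(t) = v0 + ∫₀ᵗ v'(s) ds`. -/
def HasTimeDeriv {X : Type*} [NormedAddCommGroup X] [NormedSpace ℝ X] (T : ℝ) (v v' : ℝ → X)
    (v0 : X) : Prop :=
  Integrable v' (timeMeasure T) ∧ ∀ᵐ t ∂(timeMeasure T), v t = v0 + ∫ s in (0 : ℝ)..t, v' s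

/-- `u` is the weak solution of `u_tt - ∇ · (a ∇u) = f` in `(0, T) × Ω`, `u = 0` on the lateral
boundary, `u(0) = u0`, `u_t(0) = u1`. -/
structure IsWaveSolution {Ω : Opens (EuclideanSpace ℝ (Fin d))} (a : DiffusionCoeff Ω) (T : ℝ)
    (f : ℝ → L2 Ω) (u0 : H10 Ω) (u1 : L2 Ω)
    (u : ℝ → H10 Ω) (ut : ℝ → L2 Ω) (utt : ℝ → Hm1 Ω) : Prop where
  memLp_u : MemLp u 2 (timeMeasure T)
  memLp_ut : MemLp ut 2 (timeMeasure T)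
  memLp_utt : MemLp utt 2 (timeMeasure T)
  deriv_u : HasTimeDeriv T (fun t => toL2 Ω (u t)) ut (toL2 Ω u0)
  deriv_ut : HasTimeDeriv T (fun t => toHm1 Ω (ut t)) utt (toHm1 Ω u1)
  equation : ∀ᵐ t ∂(timeMeasure T), ∀ v : H10 Ω,
    utt t v + energyForm a (u t) v = ⟪f t, toL2 Ω v⟫_ℝ

/-- `U` is a semidiscrete Galerkin solution in `Vh` with initial values `U(0) = U0`,
`U_t(0) = U1`. -/
structure IsSemidiscreteSolution {Ω : Opens (EuclideanSpace ℝ (Fin d))} (a : DiffusionCoeff Ω)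
    (T : ℝ) (f : ℝ → L2 Ω) (Vh : Submodule ℝ (H10 Ω)) (U0 U1 : Vh) (U Ut Utt : ℝ → Vh) :
    Prop where
  memLp_U : MemLp U 2 (timeMeasure T)
  deriv_U : HasTimeDeriv T U Ut U0
  deriv_Ut : HasTimeDeriv T Ut Utt U1
  equation : ∀ V : ℝ → Vh, MemLp V 2 (timeMeasure T) → ∀ᵐ t ∂(timeMeasure T),
    ⟪toL2 Ω (Utt t), toL2 Ω (V t)⟫_ℝ + energyForm a (U t) (V t) = ⟪f t, toL2 Ω (V t)⟫_ℝ

/-- `w` is the elliptic reconstruction of `U`: `a(w, v) = ⟨g, v⟩` for all `v ∈ H¹₀(Ω)`, where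
`g = A U - Π f + f`. -/
structure IsEllipticReconstruction {Ω : Opens (EuclideanSpace ℝ (Fin d))} (a : DiffusionCoeff Ω)
    (T : ℝ) (f : ℝ → L2 Ω) (Vh : Submodule ℝ (H10 Ω)) [FiniteDimensional ℝ Vh]
    (U : ℝ → Vh) (w : ℝ → H10 Ω) : Prop where
  aestronglyMeasurable : AEStronglyMeasurable w (timeMeasure T)
  equation : ∀ᵐ t ∂(timeMeasure T), ∀ v : H10 Ω,
    energyForm a (w t) v =
      ⟪toL2 Ω (discreteElliptic a Vh (U t)) - projL2 Vh (f t) + f t, toL2 Ω v⟫_ℝ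

end WaveFEM

end

/-! Write `e = U - u` and `ρ = w - u = e + ε`. The right-hand side defining `w` is chosen so that
`⟨U_tt, v⟩ + a(w, v) = ⟨f, v⟩` holds for every `v ∈ H¹₀(Ω)`, not only for `v ∈ Vh`. Subtracting the
wave equation cancels `f` and leaves `⟨e_tt, v⟩ + a(ρ, v) = 0`.

Here `e_tt` lies only in `H⁻¹(Ω)` and `e_t` only in `L²(Ω)`, so the equation is integrated once in
time: `⟨e_t(t), v⟩ = ⟨e_t(0), v⟩ - a(P(t), v)` with `P(t) = ∫₀ᵗ ρ` (`ae_inner_error_eq`). Taking `v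
= ρ(t)`, with `e_t = ρ_t - ε_t` and `ρ = P'`, makes both `⟨ρ_t, ρ⟩` and `a(P, ρ)` exact derivatives.
This gives `energy_identity`: `½‖ρ(τ)‖² + ½a(P(τ), P(τ)) = ½‖ρ(0)‖² + ∫₀^τ ⟨ρ, ε_t⟩ + ⟨e_t(0),
P(τ)⟩`.

At a time `τ` where `‖ρ‖` is maximal the last term is bounded either by `T‖e_t(0)‖‖ρ(τ)‖`, or by
Poincaré–Friedrichs and Young with the energy of `P(τ)` absorbed on the left. These are the two
entries of the minimum (`norm_le_of_energy`). The argument yields the constants `1` and `√(C/αmin)`,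
sharper than the stated `√2` and `√(2C/αmin)`. The triangle inequality `‖e‖ ≤ ‖ε‖ + ‖ρ‖` finishes.
-/

namespace WaveFEM

/-! ### Symmetric bilinear forms along primitives of integrable functions. -/

section Primitive

variable {E : Type*} [NormedAddCommGroup E] [NormedSpace ℝ E]

theorem continuousOn_add_primitive {f : ℝ → E} {a b : ℝ} (hab : a ≤ b)
    (hf : IntervalIntegrable f volume a b) (x : E) :
    ContinuousOn (fun t => x + ∫ s in a..t, f s) (Icc a b) := by
  have := intervalIntegral.continuousOn_primitive_interval' hf left_mem_uIcc
  rw [uIcc_of_le hab] at this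
  exact continuousOn_const.add this

/-- A continuous function paired with an integrable one is integrable. -/
theorem intervalIntegrable_bilin {F : Type*} [NormedAddCommGroup F] [NormedSpace ℝ F]
    (B : E →L[ℝ] F →L[ℝ] ℝ) {g : ℝ → E} {f : ℝ → F} {a b : ℝ} (hab : a ≤ b)
    (hg : ContinuousOn g (Icc a b)) (hf : IntervalIntegrable f volume a b) :
    IntervalIntegrable (fun t => B (g t) (f t)) volume a b := by
  rw [intervalIntegrable_iff_integrableOn_Icc_of_le hab] at hf ⊢
  obtain ⟨C, hC⟩ := isCompact_Icc.exists_bound_of_continuousOn hg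
  refine Integrable.mono' (hf.norm.const_mul (‖B‖ * C)) ?_ ?_
  · exact B.aestronglyMeasurable_comp₂ (hg.aestronglyMeasurable measurableSet_Icc)
      hf.aestronglyMeasurable
  · filter_upwards [ae_restrict_mem measurableSet_Icc] with t ht
    refine (B.le_opNorm₂ _ _).trans ?_
    gcongr
    exact hC t ht

variable [CompleteSpace E]

/-- This is `∫ B(F, F') = B(F, F)/2` for `F` merely absolutely continuous. Fubini replaces
differentiation: `B(F(b), F(b))` is the integral of `B (f s) (f t)` over a square, and the two
triangles cut off by the diagonal contribute equally because `B` is symmetric. -/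
theorem integral_bilin_primitive_zero (B : E →L[ℝ] E →L[ℝ] ℝ) (hB : ∀ x y, B x y = B y x)
    {f : ℝ → E} {a b : ℝ} (hab : a ≤ b) (hf : IntervalIntegrable f volume a b) :
    ∫ t in a..b, B (∫ s in a..t, f s) (f t) =
      B (∫ s in a..b, f s) (∫ s in a..b, f s) / 2 := by
  rw [intervalIntegrable_iff_integrableOn_Ioc_of_le hab] at hf
  set μ : Measure ℝ := volume.restrict (Ioc a b) with hμ
  have hf' : Integrable f μ := hf
  set K : ℝ × ℝ → ℝ := fun z => B (f z.1) (f z.2) with hKdef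
  have hK : Integrable K (μ.prod μ) :=
    hf'.op_fst_snd (by fun_prop) ⟨‖B‖, B.le_opNorm₂⟩ hf'
  have hS : MeasurableSet {z : ℝ × ℝ | z.1 ≤ z.2} := measurableSet_le measurable_fst measurable_snd
  have hprim : ∀ t ∈ Ioc a b, ∀ g : ℝ → E,
      ∫ s in a..t, g s = ∫ s, (Iic t).indicator g s ∂μ := by
    intro t ht g
    rw [intervalIntegral.integral_of_le ht.1.le, integral_indicator measurableSet_Iic,
      Measure.restrict_restrict measurableSet_Iic]
    congr 2
    ext s
    simp only [mem_Ioc, mem_inter_iff, mem_Iic]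
    exact ⟨fun h => ⟨h.2, h.1, h.2.trans ht.2⟩, fun h => ⟨h.2.1, h.1⟩⟩
  -- The complementary triangle is open along the diagonal, so its slices are `Iio t` instead of
  -- `Iic t`; the single point is null.
  have hprim' : ∀ t ∈ Ioc a b, ∀ g : ℝ → E,
      ∫ s in a..t, g s = ∫ s, (Iio t).indicator g s ∂μ := by
    intro t ht g
    rw [hprim t ht g, integral_indicator measurableSet_Iic, integral_indicator measurableSet_Iio]
    exact setIntegral_congr_set (Iio_ae_eq_Iic' (by simp [hμ])).symm
  have e1 : ∫ z, {z : ℝ × ℝ | z.1 ≤ z.2}.indicator K z ∂(μ.prod μ) =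
      ∫ t in a..b, B (∫ s in a..t, f s) (f t) := by
    rw [integral_prod_symm _ (hK.indicator hS), intervalIntegral.integral_of_le hab]
    refine setIntegral_congr_fun measurableSet_Ioc fun t ht => ?_
    rw [hprim t ht f]
    have : ∀ s, {z : ℝ × ℝ | z.1 ≤ z.2}.indicator K (s, t) =
        B.flip (f t) ((Iic t).indicator f s) := by
      intro s
      by_cases h : s ≤ t <;> simp [indicator, h, hKdef]
    simp_rw [this]
    rw [ContinuousLinearMap.integral_comp_comm _ (hf'.indicator measurableSet_Iic)]
    simp
  have e2 : ∫ z, {z : ℝ × ℝ | z.1 ≤ z.2}ᶜ.indicator K z ∂(μ.prod μ) =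
      ∫ t in a..b, B (∫ s in a..t, f s) (f t) := by
    rw [integral_prod _ (hK.indicator hS.compl), intervalIntegral.integral_of_le hab]
    refine setIntegral_congr_fun measurableSet_Ioc fun t ht => ?_
    rw [hprim' t ht f]
    have : ∀ s, {z : ℝ × ℝ | z.1 ≤ z.2}ᶜ.indicator K (t, s) =
        B (f t) ((Iio t).indicator f s) := by
      intro s
      by_cases h : s < t <;> simp [indicator, h, hKdef]
    simp_rw [this]
    rw [ContinuousLinearMap.integral_comp_comm _ (hf'.indicator measurableSet_Iio), hB]
  have e3 : ∫ z, K z ∂(μ.prod μ) = B (∫ s in a..b, f s) (∫ s in a..b, f s) := by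
    rw [integral_prod_bilin B hf' hf', intervalIntegral.integral_of_le hab]
  have e4 := integral_add (hK.indicator hS) (hK.indicator hS.compl)
  simp_rw [indicator_self_add_compl_apply] at e4
  linarith

theorem integral_bilin_primitive (B : E →L[ℝ] E →L[ℝ] ℝ) (hB : ∀ x y, B x y = B y x)
    {f : ℝ → E} {a b : ℝ} (hab : a ≤ b) (hf : IntervalIntegrable f volume a b) (x : E) :
    ∫ t in a..b, B (x + ∫ s in a..t, f s) (f t) =
      (B (x + ∫ s in a..b, f s) (x + ∫ s in a..b, f s) - B x x) / 2 := by
  have h1 : IntervalIntegrable (fun t => B x (f t)) volume a b :=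
    intervalIntegrable_bilin B hab continuousOn_const hf
  have h2 : IntervalIntegrable (fun t => B (∫ s in a..t, f s) (f t)) volume a b := by
    refine intervalIntegrable_bilin B hab ?_ hf
    simpa using continuousOn_add_primitive hab hf 0
  simp only [map_add, add_apply]
  rw [intervalIntegral.integral_add h1 h2, integral_bilin_primitive_zero B hB hab hf,
    ContinuousLinearMap.intervalIntegral_comp_comm _ hf,
    hB (∫ s in a..b, f s) x]
  ring

end Primitive

theorem ae_uIoc_of_ae_timeMeasure {T τ : ℝ} (h0 : 0 ≤ τ) (hτ : τ ≤ T) {p : ℝ → Prop}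
    (hp : ∀ᵐ t ∂(timeMeasure T), p t) : ∀ᵐ t, t ∈ uIoc 0 τ → p t := by
  rw [timeMeasure, Measure.restrict_congr_set Ioo_ae_eq_Ioc, ae_restrict_iff' measurableSet_Ioc] at hp
  filter_upwards [hp] with t ht h
  rw [uIoc_of_le h0] at h
  exact ht ⟨h.1, h.2.trans hτ⟩

theorem _root_.MeasureTheory.Integrable.intervalIntegrable_timeMeasure {X : Type*}
    [NormedAddCommGroup X] {T τ : ℝ} (h0 : 0 ≤ τ) (hτ : τ ≤ T) {v : ℝ → X}
    (hv : Integrable v (timeMeasure T)) : IntervalIntegrable v volume 0 τ :=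
  (intervalIntegrable_iff_integrableOn_Ioo_of_le h0).2
    (IntegrableOn.mono_set hv (Ioo_subset_Ioo_right hτ))

/-! ### The abstract energy argument. -/

section Energy

variable {V H : Type*} [NormedAddCommGroup V] [NormedSpace ℝ V] [CompleteSpace V]
  [NormedAddCommGroup H] [InnerProductSpace ℝ H] [CompleteSpace H]

/-- The energy identity for `η' + B ρ = 0`, `(J ρ)' = η + ζ`, tested with the time integral of
`ρ`. -/
theorem energy_identity (J : V →L[ℝ] H) (B : V →L[ℝ] V →L[ℝ] ℝ) (hB : ∀ x y, B x y = B y x)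
    {T : ℝ} {ρ : ℝ → V} {η ζ : ℝ → H} {r0 e1 : H}
    (hρ : Integrable ρ (timeMeasure T)) (hη : Integrable η (timeMeasure T))
    (hζ : Integrable ζ (timeMeasure T))
    (h1 : ∀ᵐ t ∂(timeMeasure T), J (ρ t) = r0 + ∫ s in (0 : ℝ)..t, (η s + ζ s))
    (h2 : ∀ᵐ t ∂(timeMeasure T), ∀ v : V,
      ⟪η t, J v⟫_ℝ = ⟪e1, J v⟫_ℝ - B (∫ s in (0 : ℝ)..t, ρ s) v)
    {τ : ℝ} (h0 : 0 ≤ τ) (hτ : τ ≤ T) :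
    (‖r0 + ∫ s in (0 : ℝ)..τ, (η s + ζ s)‖ ^ 2 - ‖r0‖ ^ 2) / 2 =
      (∫ t in (0 : ℝ)..τ, ⟪r0 + ∫ s in (0 : ℝ)..t, (η s + ζ s), ζ t⟫_ℝ) +
        ⟪e1, J (∫ s in (0 : ℝ)..τ, ρ s)⟫_ℝ -
        B (∫ s in (0 : ℝ)..τ, ρ s) (∫ s in (0 : ℝ)..τ, ρ s) / 2 := by
  have iρ := hρ.intervalIntegrable_timeMeasure h0 hτ
  have iη := hη.intervalIntegrable_timeMeasure h0 hτ
  have iζ := hζ.intervalIntegrable_timeMeasure h0 hτ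
  have iηζ : IntervalIntegrable (fun s => η s + ζ s) volume 0 τ := iη.add iζ
  have cR := continuousOn_add_primitive h0 iηζ r0
  set R : ℝ → H := fun t => r0 + ∫ s in (0 : ℝ)..t, (η s + ζ s) with hR
  have k1 : ∫ t in (0 : ℝ)..τ, ⟪R t, η t + ζ t⟫_ℝ = (⟪R τ, R τ⟫_ℝ - ⟪r0, r0⟫_ℝ) / 2 :=
    integral_bilin_primitive (innerSL ℝ) (fun x y => real_inner_comm y x) h0 iηζ r0
  have j1 : IntervalIntegrable (fun t => ⟪R t, η t⟫_ℝ) volume 0 τ :=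
    intervalIntegrable_bilin (innerSL ℝ) h0 cR iη
  have j2 : IntervalIntegrable (fun t => ⟪R t, ζ t⟫_ℝ) volume 0 τ :=
    intervalIntegrable_bilin (innerSL ℝ) h0 cR iζ
  simp only [inner_add_right, real_inner_self_eq_norm_sq] at k1
  rw [intervalIntegral.integral_add j1 j2] at k1
  have j3 : IntervalIntegrable (fun t => ⟪e1, J (ρ t)⟫_ℝ) volume 0 τ :=
    intervalIntegrable_bilin (innerSL ℝ) h0 continuousOn_const
      ⟨J.integrable_comp iρ.1, J.integrable_comp iρ.2⟩
  have j4 : IntervalIntegrable (fun t => B (∫ s in (0 : ℝ)..t, ρ s) (ρ t)) volume 0 τ := by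
    refine intervalIntegrable_bilin B h0 ?_ iρ
    simpa using continuousOn_add_primitive h0 iρ 0
  -- The test vector is `ρ t` itself, which varies with `t`; this is why `h2` has one null set valid
  -- for all `v`.
  have k2 : ∫ t in (0 : ℝ)..τ, ⟪R t, η t⟫_ℝ =
      ∫ t in (0 : ℝ)..τ, (⟪e1, J (ρ t)⟫_ℝ - B (∫ s in (0 : ℝ)..t, ρ s) (ρ t)) := by
    refine intervalIntegral.integral_congr_ae ?_
    filter_upwards [ae_uIoc_of_ae_timeMeasure h0 hτ h1, ae_uIoc_of_ae_timeMeasure h0 hτ h2]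
      with t ht1 ht2 ht
    rw [← ht2 ht, ht1 ht, real_inner_comm]
  rw [intervalIntegral.integral_sub j3 j4, integral_bilin_primitive_zero B hB h0 iρ] at k2
  have k3 : ∫ t in (0 : ℝ)..τ, ⟪e1, J (ρ t)⟫_ℝ = ⟪e1, J (∫ s in (0 : ℝ)..τ, ρ s)⟫_ℝ :=
    ((innerSL ℝ e1).comp J).intervalIntegral_comp_comm iρ
  linarith

/-- If `M > r + 2I + k`, then `M (M - 2I) > (r + 2I + k)(r + k) ≥ r² + k²`. -/
theorem le_of_sq_le_mul_add {M r I k : ℝ} (hI : 0 ≤ I) (hr : 0 ≤ r)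
    (hk : 0 ≤ k) (h : M ^ 2 ≤ r ^ 2 + 2 * M * I + k ^ 2) : M ≤ r + 2 * I + k := by
  by_contra! hlt
  nlinarith [mul_nonneg hI hr, mul_nonneg hI hk, mul_nonneg hr hk, mul_nonneg hI hI]

theorem norm_le_of_energy (J : V →L[ℝ] H) (B : V →L[ℝ] V →L[ℝ] ℝ) (hB : ∀ x y, B x y = B y x)
    {κ : ℝ} (hκ : 0 ≤ κ) (hJ : ∀ v, ‖J v‖ ^ 2 ≤ κ * B v v) (hB0 : ∀ v, 0 ≤ B v v)
    {T : ℝ} (hT : 0 ≤ T) {ρ : ℝ → V} {η ζ : ℝ → H} {r0 e1 : H}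
    (hρ : Integrable ρ (timeMeasure T)) (hη : Integrable η (timeMeasure T))
    (hζ : Integrable ζ (timeMeasure T))
    (h1 : ∀ᵐ t ∂(timeMeasure T), J (ρ t) = r0 + ∫ s in (0 : ℝ)..t, (η s + ζ s))
    (h2 : ∀ᵐ t ∂(timeMeasure T), ∀ v : V,
      ⟪η t, J v⟫_ℝ = ⟪e1, J v⟫_ℝ - B (∫ s in (0 : ℝ)..t, ρ s) v) :
    ∀ᵐ t ∂(timeMeasure T), ‖J (ρ t)‖ ≤
      ‖r0‖ + 2 * (∫ t in (0 : ℝ)..T, ‖ζ t‖) + min (2 * T) √κ * ‖e1‖ := by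
  set R : ℝ → H := fun t => r0 + ∫ s in (0 : ℝ)..t, (η s + ζ s) with hR
  have iηζ : IntervalIntegrable (fun s => η s + ζ s) volume 0 T :=
    (hη.add hζ).intervalIntegrable_timeMeasure hT le_rfl
  have cR : ContinuousOn R (Icc 0 T) := continuousOn_add_primitive hT iηζ r0
  -- The identity is used only at a maximum point of the continuous representative `R` of `J ρ`, so
  -- that every `‖R t‖` on the right is bounded by `M`.
  obtain ⟨τ, hτ, hmax⟩ := isCompact_Icc.exists_isMaxOn (nonempty_Icc.2 hT) cR.norm
  set M := ‖R τ‖ with hM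
  have hmax' : ∀ t ∈ Icc 0 T, ‖R t‖ ≤ M := fun t ht => hmax ht
  have hM0 : 0 ≤ M := norm_nonneg _
  set I := ∫ t in (0 : ℝ)..T, ‖ζ t‖ with hI
  have hI0 : 0 ≤ I := intervalIntegral.integral_nonneg hT fun _ _ => norm_nonneg _
  have iρ := hρ.intervalIntegrable_timeMeasure hτ.1 hτ.2
  have iζ := hζ.intervalIntegrable_timeMeasure hτ.1 hτ.2
  have hid := energy_identity J B hB hρ hη hζ h1 h2 hτ.1 hτ.2
  set P := ∫ s in (0 : ℝ)..τ, ρ s with hP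
  have b1 : ∫ t in (0 : ℝ)..τ, ⟪R t, ζ t⟫_ℝ ≤ M * I := by
    calc ∫ t in (0 : ℝ)..τ, ⟪R t, ζ t⟫_ℝ ≤ ∫ t in (0 : ℝ)..τ, M * ‖ζ t‖ := by
          refine intervalIntegral.integral_mono_on hτ.1 ?_ (iζ.norm.const_mul M) fun t ht => ?_
          · exact intervalIntegrable_bilin (innerSL ℝ) hτ.1
              (cR.mono (Icc_subset_Icc_right hτ.2)) iζ
          · refine (real_inner_le_norm _ _).trans ?_
            gcongr
            exact hmax' t ⟨ht.1, ht.2.trans hτ.2⟩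
      _ = M * ∫ t in (0 : ℝ)..τ, ‖ζ t‖ := intervalIntegral.integral_const_mul _ _
      _ ≤ M * I := by
          gcongr
          refine intervalIntegral.integral_mono_interval le_rfl hτ.1 hτ.2
            (Filter.Eventually.of_forall fun _ => norm_nonneg _)
            (hζ.intervalIntegrable_timeMeasure hT le_rfl).norm
  have b2 : ‖J P‖ ≤ T * M := by
    rw [hP, ← J.intervalIntegral_comp_comm iρ]
    have : ‖∫ t in (0 : ℝ)..τ, J (ρ t)‖ ≤ M * |τ - 0| := by
      refine intervalIntegral.norm_integral_le_of_norm_le_const_ae ?_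
      filter_upwards [ae_uIoc_of_ae_timeMeasure hτ.1 hτ.2 h1] with t ht1 ht
      rw [ht1 ht]
      rw [uIoc_of_le hτ.1] at ht
      exact hmax' t ⟨ht.1.le, ht.2.trans hτ.2⟩
    rw [sub_zero, abs_of_nonneg hτ.1] at this
    nlinarith [hτ.2]
  have b3 : ⟪e1, J P⟫_ℝ ≤ ‖e1‖ * ‖J P‖ := real_inner_le_norm _ _
  have b4 : ‖r0‖ ≤ M := by
    have := hmax' 0 ⟨le_rfl, hT⟩
    simpa [hR] using this
  -- Drop the energy of `P`, use `‖r0‖² ≤ ‖r0‖ M`, and divide by `M`.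
  have key1 : M ≤ ‖r0‖ + 2 * I + 2 * T * ‖e1‖ := by
    rcases hM0.eq_or_lt with h | h
    · rw [← h]; positivity
    · refine le_of_mul_le_mul_left ?_ h
      have : ‖e1‖ * ‖J P‖ ≤ ‖e1‖ * (T * M) := by gcongr
      nlinarith [hB0 P, norm_nonneg r0]
  -- Young's inequality `2 ‖e1‖ √κ √(B P P) ≤ κ ‖e1‖² + B P P` absorbs exactly the energy term of
  -- the identity.
  have key2 : M ≤ ‖r0‖ + 2 * I + √κ * ‖e1‖ := by
    refine le_of_sq_le_mul_add hI0 (norm_nonneg _) (by positivity) ?_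
    have c1 : ‖J P‖ ≤ √κ * √(B P P) := by
      rw [← Real.sqrt_mul hκ]
      exact Real.le_sqrt_of_sq_le (hJ P)
    have c2 : ‖e1‖ * ‖J P‖ ≤ ‖e1‖ * (√κ * √(B P P)) := by gcongr
    have c3 := Real.sq_sqrt (hB0 P)
    nlinarith [sq_nonneg (√κ * ‖e1‖ - √(B P P))]
  have key : M ≤ ‖r0‖ + 2 * I + min (2 * T) √κ * ‖e1‖ := by
    rcases min_choice (2 * T) √κ with h | h <;> rw [h] <;> assumption
  filter_upwards [h1, ae_restrict_mem measurableSet_Ioo] with t ht htm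
  rw [ht]
  exact (hmax' t ⟨htm.1.le, htm.2.le⟩).trans key

end Energy

/-! ### The Poincaré–Friedrichs inequality on bounded open sets. -/

section Poincare

variable {d : ℕ}

theorem norm_sq_eq_setIntegral {Ω : Opens (EuclideanSpace ℝ (Fin d))} {F : Type*}
    [NormedAddCommGroup F] [InnerProductSpace ℝ F]
    (g : Lp F 2 (volume.restrict (Ω : Set (EuclideanSpace ℝ (Fin d))))) :
    ‖g‖ ^ 2 = ∫ x in (Ω : Set (EuclideanSpace ℝ (Fin d))), ‖g x‖ ^ 2 := by
  rw [← real_inner_self_eq_norm_sq, L2.inner_def]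
  simp only [real_inner_self_eq_norm_sq]

theorem IsTestFunction.eq_zero_of_notMem {Ω : Opens (EuclideanSpace ℝ (Fin d))}
    {φ : EuclideanSpace ℝ (Fin d) → ℝ} (hφ : IsTestFunction Ω φ) {x : EuclideanSpace ℝ (Fin d)}
    (hx : x ∉ (Ω : Set (EuclideanSpace ℝ (Fin d)))) : φ x = 0 :=
  image_eq_zero_of_notMem_tsupport fun h => hx (hφ.3 h)

theorem IsTestFunction.gradient_eq_zero_of_notMem {Ω : Opens (EuclideanSpace ℝ (Fin d))}
    {φ : EuclideanSpace ℝ (Fin d) → ℝ} (hφ : IsTestFunction Ω φ) {x : EuclideanSpace ℝ (Fin d)}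
    (hx : x ∉ (Ω : Set (EuclideanSpace ℝ (Fin d)))) : ∇ φ x = 0 := by
  have : fderiv ℝ φ x = 0 :=
    image_eq_zero_of_notMem_tsupport fun h => hx (hφ.3 (tsupport_fderiv_subset ℝ h))
  simp [gradient, this]

/-- Since `p y = 1`, integrating `∂_y (p φ²)` to zero gives `∫ φ² = -2 ∫ p φ ∂_y φ`. With `|p| ≤ R`
on `Ω`, Young's inequality bounds the right side by `½ ∫ φ² + 2R² ∫ |∇φ|²`, and half of `∫ φ²` is
absorbed. -/
theorem IsTestFunction.integral_sq_le_of_clm {Ω : Opens (EuclideanSpace ℝ (Fin d))}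
    {R : ℝ} (hR : ∀ x ∈ (Ω : Set (EuclideanSpace ℝ (Fin d))), ‖x‖ ≤ R)
    {φ : EuclideanSpace ℝ (Fin d) → ℝ} (hφ : IsTestFunction Ω φ)
    {p : EuclideanSpace ℝ (Fin d) →L[ℝ] ℝ} (hp : ∀ x, |p x| ≤ ‖x‖)
    {y : EuclideanSpace ℝ (Fin d)} (hy1 : ‖y‖ = 1) (py : p y = 1) :
    ∫ x, ‖φ x‖ ^ 2 ≤ 4 * R ^ 2 * ∫ x, ‖∇ φ x‖ ^ 2 := by
  have hφd : Differentiable ℝ φ := hφ.1.differentiable (by simp)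
  have cφ : Continuous φ := hφ.1.continuous
  have cD : Continuous fun x => fderiv ℝ φ x y :=
    (hφ.1.continuous_fderiv (by simp)).clm_apply continuous_const
  have cG : Continuous (∇ φ) :=
    (InnerProductSpace.toDual ℝ (EuclideanSpace ℝ (Fin d))).symm.continuous.comp
      (hφ.1.continuous_fderiv (by simp))
  have sG : HasCompactSupport (∇ φ) :=
    (hφ.2.fderiv ℝ).mono fun x hx => by
      contrapose! hx
      simp only [Function.mem_support, not_not] at hx ⊢
      simp [gradient, hx]
  have cp : Continuous p := p.continuous
  have hfd : ∀ x, fderiv ℝ (fun x => p x * φ x) x y = φ x + p x * fderiv ℝ φ x y := by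
    intro x
    rw [fderiv_fun_mul p.differentiableAt (hφd x)]
    simp [py]
    ring
  have i1 : Integrable fun x => φ x * φ x :=
    (cφ.mul cφ).integrable_of_hasCompactSupport hφ.2.mul_right
  have i2 : Integrable fun x => p x * φ x * fderiv ℝ φ x y :=
    ((cp.mul cφ).mul cD).integrable_of_hasCompactSupport hφ.2.mul_left.mul_right
  have i3 : Integrable fun x => ‖∇ φ x‖ ^ 2 :=
    (cG.norm.pow 2).integrable_of_hasCompactSupport
      (sG.mono fun x hx => by
        contrapose! hx
        simp only [Function.mem_support, not_not] at hx ⊢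
        simp [hx])
  have parts := integral_mul_fderiv_eq_neg_fderiv_mul_of_integrable (𝕜 := ℝ)
    (f := fun x => p x * φ x) (g := φ) (v := y) (μ := volume) ?_ i2 ?_
    (fun x _ => (p.differentiableAt).mul (hφd x)) (fun x _ => hφd x)
  · have e : ∀ x, fderiv ℝ (fun x => p x * φ x) x y * φ x =
        φ x * φ x + p x * φ x * fderiv ℝ φ x y := fun x => by rw [hfd]; ring
    simp only [e] at parts
    rw [integral_add i1 i2] at parts
    have pw : ∀ x, -2 * (p x * φ x * fderiv ℝ φ x y) ≤
        1 / 2 * (φ x * φ x) + 2 * R ^ 2 * ‖∇ φ x‖ ^ 2 := by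
      intro x
      by_cases hx : x ∈ (Ω : Set (EuclideanSpace ℝ (Fin d)))
      · have a1 : |p x| ≤ R := (hp x).trans (hR x hx)
        have a2 : |fderiv ℝ φ x y| ≤ ‖∇ φ x‖ := by
          rw [← inner_gradient_left]
          simpa [hy1] using abs_real_inner_le_norm (∇ φ x) y
        have a3 : |p x * fderiv ℝ φ x y| ≤ R * ‖∇ φ x‖ := by
          rw [abs_mul]
          exact mul_le_mul a1 a2 (abs_nonneg _) ((abs_nonneg _).trans a1)
        have a4 : (p x * fderiv ℝ φ x y) ^ 2 ≤ (R * ‖∇ φ x‖) ^ 2 := sq_le_sq.2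
          (a3.trans (le_abs_self _))
        nlinarith [sq_nonneg (φ x + 2 * (p x * fderiv ℝ φ x y))]
      -- Off `Ω` the functional `p` need not be bounded by `R`, but `φ` vanishes there.
      · rw [hφ.eq_zero_of_notMem hx]
        simp only [mul_zero, zero_mul, zero_add]
        positivity
    have mono := integral_mono (i2.const_mul (-2))
      ((i1.const_mul (1 / 2)).add (i3.const_mul (2 * R ^ 2))) pw
    simp only [Pi.add_apply] at mono
    rw [integral_add (i1.const_mul (1 / 2)) (i3.const_mul (2 * R ^ 2))] at mono
    simp only [integral_const_mul] at mono
    simp only [Real.norm_eq_abs, sq_abs, sq (φ _)]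
    linarith
  · simp only [hfd]
    exact ((cφ.add (cp.mul cD)).mul cφ).integrable_of_hasCompactSupport hφ.2.mul_left
  · exact ((cp.mul cφ).mul cφ).integrable_of_hasCompactSupport hφ.2.mul_left

theorem IsTestFunction.integral_sq_le {Ω : Opens (EuclideanSpace ℝ (Fin d))} (hd : 0 < d)
    {R : ℝ} (hR : ∀ x ∈ (Ω : Set (EuclideanSpace ℝ (Fin d))), ‖x‖ ≤ R)
    {φ : EuclideanSpace ℝ (Fin d) → ℝ} (hφ : IsTestFunction Ω φ) :
    ∫ x, ‖φ x‖ ^ 2 ≤ 4 * R ^ 2 * ∫ x, ‖∇ φ x‖ ^ 2 :=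
  hφ.integral_sq_le_of_clm hR (p := EuclideanSpace.proj (⟨0, hd⟩ : Fin d))
    (y := EuclideanSpace.single ⟨0, hd⟩ 1)
    (fun x => by simpa using PiLp.norm_apply_le x (⟨0, hd⟩ : Fin d)) (by simp) (by simp)

/-- Both sides are continuous in the `H¹`-norm, so the inequality for test functions passes to their
closure. -/
theorem exists_isPoincareConst (hd : 0 < d) {Ω : Opens (EuclideanSpace ℝ (Fin d))}
    (hΩ : Bornology.IsBounded (Ω : Set (EuclideanSpace ℝ (Fin d)))) :
    ∃ C : ℝ, IsPoincareConst Ω C := by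
  obtain ⟨R, hR⟩ := hΩ.exists_norm_le
  refine ⟨4 * R ^ 2, fun v => ?_⟩
  have key : closure (testGraph Ω : Set (WithLp 2 (L2 Ω × L2Vec Ω))) ⊆
      {p | ‖p.fst‖ ^ 2 ≤ 4 * R ^ 2 * ‖p.snd‖ ^ 2} := by
    refine closure_minimal ?_ (isClosed_le ?_ ?_)
    · rintro p ⟨φ, hφ, hp1, hp2⟩
      rw [mem_ofPred_eq, norm_sq_eq_setIntegral, norm_sq_eq_setIntegral]
      have e1 : ∫ x in (Ω : Set (EuclideanSpace ℝ (Fin d))), ‖p.fst x‖ ^ 2 = ∫ x, ‖φ x‖ ^ 2 := by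
        rw [← setIntegral_eq_integral_of_forall_compl_eq_zero
          (s := (Ω : Set (EuclideanSpace ℝ (Fin d)))) (f := fun x => ‖φ x‖ ^ 2)]
        · refine integral_congr_ae ?_
          filter_upwards [hp1] with x hx
          rw [hx]
        · intro x hx
          simp [hφ.eq_zero_of_notMem hx]
      have e2 : ∫ x in (Ω : Set (EuclideanSpace ℝ (Fin d))), ‖p.snd x‖ ^ 2 =
          ∫ x, ‖∇ φ x‖ ^ 2 := by
        rw [← setIntegral_eq_integral_of_forall_compl_eq_zero
          (s := (Ω : Set (EuclideanSpace ℝ (Fin d)))) (f := fun x => ‖∇ φ x‖ ^ 2)]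
        · refine integral_congr_ae ?_
          filter_upwards [hp2] with x hx
          rw [hx]
        · intro x hx
          simp [hφ.gradient_eq_zero_of_notMem hx]
      rw [e1, e2]
      exact hφ.integral_sq_le hd hR
    · exact (WithLp.fstL 2 ℝ (L2 Ω) (L2Vec Ω)).continuous.norm.pow 2
    · exact continuous_const.mul ((WithLp.sndL 2 ℝ (L2 Ω) (L2Vec Ω)).continuous.norm.pow 2)
  exact key v.2

end Poincare

/-! ### Boundedness and coercivity of the energy form. -/

variable {d : ℕ} {Ω : Opens (EuclideanSpace ℝ (Fin d))}

instance : CompleteSpace (H10 Ω) :=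
  (Submodule.isClosed_topologicalClosure (testGraph Ω)).completeSpace_coe

theorem norm_sq_H10 (v : H10 Ω) : ‖v‖ ^ 2 = ‖toL2 Ω v‖ ^ 2 + ‖grad Ω v‖ ^ 2 :=
  WithLp.prod_norm_sq_eq_of_L2 _

theorem energyForm_apply (a : DiffusionCoeff Ω) (z v : H10 Ω) :
    energyForm a z v = ∫ x in (Ω : Set (EuclideanSpace ℝ (Fin d))),
      a.toFun x * ⟪grad Ω z x, grad Ω v x⟫_ℝ := rfl

theorem energyForm_symm (a : DiffusionCoeff Ω) (z v : H10 Ω) :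
    energyForm a z v = energyForm a v z := by
  rw [energyForm_apply, energyForm_apply]
  exact integral_congr_ae (Filter.Eventually.of_forall fun x => by
    dsimp only
    rw [real_inner_comm])

theorem le_energyForm_self (a : DiffusionCoeff Ω) (v : H10 Ω) :
    a.αmin * ‖grad Ω v‖ ^ 2 ≤ energyForm a v v := by
  rw [norm_sq_eq_setIntegral, energyForm_apply, ← integral_const_mul]
  refine integral_mono_ae ?_ (a.integrable _ _) ?_
  · have := L2.integrable_inner (𝕜 := ℝ) (grad Ω v) (grad Ω v)
    simp only [real_inner_self_eq_norm_sq] at this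
    exact this.const_mul _
  · filter_upwards [ae_restrict_mem Ω.isOpen.measurableSet] with x hx
    rw [real_inner_self_eq_norm_sq]
    gcongr
    exact a.lower x (subset_closure hx)

/-- The absolute value covers empty `Ω`, where nothing forces `a.αmax` to be nonnegative. -/
theorem energyForm_self_le (a : DiffusionCoeff Ω) (v : H10 Ω) :
    energyForm a v v ≤ |a.αmax| * ‖v‖ ^ 2 := by
  have h : energyForm a v v ≤ |a.αmax| * ‖grad Ω v‖ ^ 2 := by
    rw [norm_sq_eq_setIntegral, energyForm_apply, ← integral_const_mul]
    refine integral_mono_ae (a.integrable _ _) ?_ ?_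
    · have := L2.integrable_inner (𝕜 := ℝ) (grad Ω v) (grad Ω v)
      simp only [real_inner_self_eq_norm_sq] at this
      exact this.const_mul _
    · filter_upwards [ae_restrict_mem Ω.isOpen.measurableSet] with x hx
      rw [real_inner_self_eq_norm_sq]
      gcongr
      exact (a.upper x (subset_closure hx)).trans (le_abs_self _)
  refine h.trans ?_
  gcongr 1
  rw [norm_sq_H10]
  linarith [sq_nonneg ‖toL2 Ω v‖]

theorem energyForm_self_nonneg (a : DiffusionCoeff Ω) (v : H10 Ω) : 0 ≤ energyForm a v v :=
  (mul_nonneg a.αmin_pos.le (sq_nonneg _)).trans (le_energyForm_self a v)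

/-- Cauchy–Schwarz for the positive semidefinite form reduces this to the diagonal bound. -/
theorem abs_energyForm_le (a : DiffusionCoeff Ω) (z v : H10 Ω) :
    |energyForm a z v| ≤ |a.αmax| * ‖z‖ * ‖v‖ := by
  refine abs_le_of_sq_le_sq ?_ (by positivity)
  calc energyForm a z v ^ 2 ≤ energyForm a z z * energyForm a v v :=
        (energyForm a).apply_sq_le_of_symm (energyForm_self_nonneg a)
          ⟨fun x y => energyForm_symm a x y⟩ z v
    _ ≤ (|a.αmax| * ‖z‖ ^ 2) * (|a.αmax| * ‖v‖ ^ 2) :=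
        mul_le_mul (energyForm_self_le a z) (energyForm_self_le a v)
          (energyForm_self_nonneg a v) (by positivity)
    _ = (|a.αmax| * ‖z‖ * ‖v‖) ^ 2 := by ring

/-- The energy form as a bounded bilinear form on `H¹₀(Ω)`. -/
noncomputable def energyFormL (a : DiffusionCoeff Ω) : H10 Ω →L[ℝ] H10 Ω →L[ℝ] ℝ :=
  LinearMap.mkContinuous₂ (energyForm a) |a.αmax| (abs_energyForm_le a)

/-- A Poincaré constant may be negative when `H¹₀(Ω)` is trivial; `max C 0` keeps the factor
nonnegative. -/
theorem norm_toL2_sq_le_energyForm (a : DiffusionCoeff Ω) {C : ℝ} (hC : IsPoincareConst Ω C)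
    (v : H10 Ω) : ‖toL2 Ω v‖ ^ 2 ≤ max C 0 / a.αmin * energyForm a v v := by
  calc ‖toL2 Ω v‖ ^ 2 ≤ C * ‖grad Ω v‖ ^ 2 := hC v
    _ ≤ max C 0 * ‖grad Ω v‖ ^ 2 := by gcongr; exact le_max_left _ _
    _ = max C 0 / a.αmin * (a.αmin * ‖grad Ω v‖ ^ 2) := by
        field_simp [a.αmin_pos.ne']
    _ ≤ max C 0 / a.αmin * energyForm a v v := by
        have := a.αmin_pos
        gcongr
        exact le_energyForm_self a v

/-- The Lax–Milgram estimate for `a(w, ·) = ⟨g, ·⟩`. -/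
theorem norm_le_of_energyForm_eq (a : DiffusionCoeff Ω) {C : ℝ} (hC : IsPoincareConst Ω C)
    {w : H10 Ω} {g : L2 Ω} (h : ∀ v, energyForm a w v = ⟪g, toL2 Ω v⟫_ℝ) :
    ‖w‖ ≤ (max C 0 + 1) / a.αmin * ‖g‖ := by
  have hα := a.αmin_pos
  rcases (norm_nonneg w).eq_or_lt with h0 | h0
  · rw [← h0]; positivity
  have h1 : ‖toL2 Ω w‖ ≤ ‖w‖ := by
    refine (pow_le_pow_iff_left₀ (norm_nonneg _) h0.le two_ne_zero).1 ?_
    rw [norm_sq_H10 w]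
    linarith [sq_nonneg ‖grad Ω w‖]
  have h2 : a.αmin * ‖grad Ω w‖ ^ 2 ≤ ‖g‖ * ‖w‖ := by
    refine (le_energyForm_self a w).trans ?_
    rw [h w]
    refine (real_inner_le_norm _ _).trans ?_
    gcongr
  have h3 : ‖w‖ ^ 2 ≤ (max C 0 + 1) * ‖grad Ω w‖ ^ 2 := by
    have : ‖toL2 Ω w‖ ^ 2 ≤ max C 0 * ‖grad Ω w‖ ^ 2 :=
      (hC w).trans (by gcongr; exact le_max_left _ _)
    rw [norm_sq_H10]
    linarith
  rw [div_mul_eq_mul_div, le_div_iff₀ hα]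
  refine le_of_mul_le_mul_right ?_ h0
  have : 0 ≤ max C 0 + 1 := by positivity
  nlinarith [mul_le_mul_of_nonneg_left h2 this]

/-! ### The semidiscrete equation and the elliptic reconstruction. -/

theorem IsSemidiscreteSolution.ae_inner_eq {a : DiffusionCoeff Ω} {T : ℝ} {f : ℝ → L2 Ω}
    {Vh : Submodule ℝ (H10 Ω)} [FiniteDimensional ℝ Vh] {U0 U1 : Vh} {U Ut Utt : ℝ → Vh}
    (hU : IsSemidiscreteSolution a T f Vh U0 U1 U Ut Utt) :
    ∀ᵐ t ∂(timeMeasure T), ∀ χ : Vh,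
      ⟪toL2 Ω (Utt t), toL2 Ω χ⟫_ℝ + energyForm a (U t) χ = ⟪f t, toL2 Ω χ⟫_ℝ := by
  -- Each test function has its own null set. Testing with the finitely many constant functions `b
  -- i` leaves one null set, and linearity covers all of `Vh`.
  let b := Module.finBasis ℝ Vh
  have h : ∀ᵐ t ∂(timeMeasure T), ∀ i,
      ⟪toL2 Ω (Utt t), toL2 Ω (b i)⟫_ℝ + energyForm a (U t) (b i) = ⟪f t, toL2 Ω (b i)⟫_ℝ :=
    ae_all_iff.2 fun i => hU.equation (fun _ => b i) (memLp_const _)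
  filter_upwards [h] with t ht χ
  let φ : Vh →ₗ[ℝ] ℝ :=
    ((innerSL ℝ (toL2 Ω (Utt t) - f t)).comp (toL2 Ω)).toLinearMap ∘ₗ Vh.subtype +
      energyForm a (U t) ∘ₗ Vh.subtype
  have hφ : φ = 0 := by
    refine b.ext fun i => ?_
    have := ht i
    simp only [φ, LinearMap.add_apply, LinearMap.comp_apply, ContinuousLinearMap.coe_coe,
      ContinuousLinearMap.comp_apply, innerSL_apply_apply, Submodule.subtype_apply,
      inner_sub_left, LinearMap.zero_apply]
    linarith
  have := LinearMap.congr_fun hφ χ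
  simp only [φ, LinearMap.add_apply, LinearMap.comp_apply, ContinuousLinearMap.coe_coe,
    ContinuousLinearMap.comp_apply, innerSL_apply_apply, Submodule.subtype_apply,
    inner_sub_left, LinearMap.zero_apply] at this
  linarith

/-- The semidiscrete equation in `L²(Ω)`: `U_tt = Π f - A U`. -/
theorem IsSemidiscreteSolution.ae_toL2_eq {a : DiffusionCoeff Ω} {T : ℝ} {f : ℝ → L2 Ω}
    {Vh : Submodule ℝ (H10 Ω)} [FiniteDimensional ℝ Vh] {U0 U1 : Vh} {U Ut Utt : ℝ → Vh}
    (hU : IsSemidiscreteSolution a T f Vh U0 U1 U Ut Utt) :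
    ∀ᵐ t ∂(timeMeasure T),
      toL2 Ω (Utt t) = projL2 Vh (f t) - toL2 Ω (discreteElliptic a Vh (U t)) := by
  filter_upwards [hU.ae_inner_eq] with t ht
  rw [eq_sub_iff_add_eq, eq_comm]
  -- `U_tt + A U` lies in `Vh` and `f - (U_tt + A U)` is orthogonal to `Vh`, which characterizes `Π
  -- f`.
  refine Submodule.eq_starProjection_of_mem_of_inner_eq_zero ?_ ?_
  · exact ⟨Utt t + discreteElliptic a Vh (U t), (Utt t + discreteElliptic a Vh (U t)).2, by simp⟩
  · rintro _ ⟨χ, hχ, rfl⟩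
    have h1 := ht ⟨χ, hχ⟩
    have h2 := inner_discreteElliptic a Vh (U t) ⟨χ, hχ⟩
    simp only [ContinuousLinearMap.coe_coe, inner_sub_left, inner_add_left]
    linarith

/-- The elliptic reconstruction satisfies `⟨U_tt, v⟩ + a(w, v) = ⟨f, v⟩` on all of `H¹₀(Ω)`. -/
theorem IsEllipticReconstruction.ae_inner_eq {a : DiffusionCoeff Ω} {T : ℝ} {f : ℝ → L2 Ω}
    {Vh : Submodule ℝ (H10 Ω)} [FiniteDimensional ℝ Vh] {U0 U1 : Vh} {U Ut Utt : ℝ → Vh}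
    (hU : IsSemidiscreteSolution a T f Vh U0 U1 U Ut Utt) {w : ℝ → H10 Ω}
    (hw : IsEllipticReconstruction a T f Vh U w) :
    ∀ᵐ t ∂(timeMeasure T), ∀ v : H10 Ω,
      ⟪toL2 Ω (Utt t), toL2 Ω v⟫_ℝ + energyForm a (w t) v = ⟪f t, toL2 Ω v⟫_ℝ := by
  filter_upwards [hU.ae_toL2_eq, hw.equation] with t h1 h2 v
  rw [h1, h2, ← inner_add_left]
  congr 1
  abel

theorem _root_.MeasureTheory.Integrable.clm_comp_submodule_linearMap {α X Y : Type*}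
    [MeasurableSpace α] {μ : Measure α} [NormedAddCommGroup X] [NormedSpace ℝ X]
    [NormedAddCommGroup Y] [NormedSpace ℝ Y] {S : Submodule ℝ X} [FiniteDimensional ℝ S]
    {v : α → S} (hv : Integrable v μ) (J : X →L[ℝ] Y) (A : S →ₗ[ℝ] S) :
    Integrable (fun t => J (A (v t))) μ :=
  ((J.comp S.subtypeL).comp A.toContinuousLinearMap).integrable_comp hv

/-- Needed for `∫₀ᵗ (w - u)` to be a meaningful integral in `H¹₀(Ω)`: only measurability of `w` is
assumed, and the Lax–Milgram estimate dominates `‖w‖` by an integrable function. -/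
theorem IsEllipticReconstruction.integrable {a : DiffusionCoeff Ω} {T : ℝ} {f : ℝ → L2 Ω}
    (hf : MemLp f 2 (timeMeasure T)) {C : ℝ} (hC : IsPoincareConst Ω C)
    {Vh : Submodule ℝ (H10 Ω)} [FiniteDimensional ℝ Vh] {U : ℝ → Vh}
    (hU : MemLp U 2 (timeMeasure T)) {w : ℝ → H10 Ω}
    (hw : IsEllipticReconstruction a T f Vh U w) : Integrable w (timeMeasure T) := by
  have if' : Integrable f (timeMeasure T) := hf.integrable one_le_two
  have iU : Integrable U (timeMeasure T) := hU.integrable one_le_two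
  have iA : Integrable (fun t => toL2 Ω (discreteElliptic a Vh (U t))) (timeMeasure T) :=
    iU.clm_comp_submodule_linearMap (toL2 Ω) (discreteElliptic a Vh)
  have ig : Integrable
      (fun t => toL2 Ω (discreteElliptic a Vh (U t)) - projL2 Vh (f t) + f t) (timeMeasure T) :=
    (iA.sub ((projL2 Vh).integrable_comp if')).add if'
  refine Integrable.mono' (ig.norm.const_mul ((max C 0 + 1) / a.αmin))
    hw.aestronglyMeasurable ?_
  filter_upwards [hw.equation] with t ht
  exact norm_le_of_energyForm_eq a hC ht

/-! ### Calculus of time derivatives. -/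

theorem HasTimeDeriv.clm_comp {X Y : Type*} [NormedAddCommGroup X] [NormedSpace ℝ X]
    [CompleteSpace X] [NormedAddCommGroup Y] [NormedSpace ℝ Y] [CompleteSpace Y] {T : ℝ}
    {v v' : ℝ → X} {v0 : X} (h : HasTimeDeriv T v v' v0) (L : X →L[ℝ] Y) :
    HasTimeDeriv T (fun t => L (v t)) (fun t => L (v' t)) (L v0) := by
  refine ⟨L.integrable_comp h.1, ?_⟩
  filter_upwards [h.2, ae_restrict_mem measurableSet_Ioo] with t ht htm
  rw [ht, map_add, L.intervalIntegral_comp_comm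
    (h.1.intervalIntegrable_timeMeasure htm.1.le htm.2.le)]

theorem HasTimeDeriv.add {X : Type*} [NormedAddCommGroup X] [NormedSpace ℝ X] {T : ℝ}
    {v v' z z' : ℝ → X} {v0 z0 : X} (hv : HasTimeDeriv T v v' v0) (hz : HasTimeDeriv T z z' z0) :
    HasTimeDeriv T (fun t => v t + z t) (fun t => v' t + z' t) (v0 + z0) := by
  refine ⟨hv.1.add hz.1, ?_⟩
  filter_upwards [hv.2, hz.2, ae_restrict_mem measurableSet_Ioo] with t h1 h2 htm
  rw [h1, h2, intervalIntegral.integral_add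
    (hv.1.intervalIntegrable_timeMeasure htm.1.le htm.2.le)
    (hz.1.intervalIntegrable_timeMeasure htm.1.le htm.2.le)]
  abel

theorem HasTimeDeriv.sub {X : Type*} [NormedAddCommGroup X] [NormedSpace ℝ X] {T : ℝ}
    {v v' z z' : ℝ → X} {v0 z0 : X} (hv : HasTimeDeriv T v v' v0) (hz : HasTimeDeriv T z z' z0) :
    HasTimeDeriv T (fun t => v t - z t) (fun t => v' t - z' t) (v0 - z0) := by
  refine ⟨hv.1.sub hz.1, ?_⟩
  filter_upwards [hv.2, hz.2, ae_restrict_mem measurableSet_Ioo] with t h1 h2 htm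
  rw [h1, h2, intervalIntegral.integral_sub
    (hv.1.intervalIntegrable_timeMeasure htm.1.le htm.2.le)
    (hz.1.intervalIntegrable_timeMeasure htm.1.le htm.2.le)]
  abel

/-! ### The error equation and the bound on `w - u`. -/

section ErrorBound

variable {a : DiffusionCoeff Ω} {T : ℝ} {f : ℝ → L2 Ω} {u0 : H10 Ω} {u1 : L2 Ω} {u : ℝ → H10 Ω}
  {ut : ℝ → L2 Ω} {utt : ℝ → Hm1 Ω} {Vh : Submodule ℝ (H10 Ω)} [FiniteDimensional ℝ Vh]
  {U0 U1 : Vh} {U Ut Utt : ℝ → Vh} {w : ℝ → H10 Ω} {ε0 : L2 Ω} {εt : ℝ → L2 Ω}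

/-- The time-integrated error equation: `⟨e_t(t), v⟩ = ⟨e_t(0), v⟩ - a(∫₀ᵗ (w - u), v)`. -/
theorem ae_inner_error_eq (hu : IsWaveSolution a T f u0 u1 u ut utt)
    (hU : IsSemidiscreteSolution a T f Vh U0 U1 U Ut Utt)
    (hw : IsEllipticReconstruction a T f Vh U w)
    (hρ : Integrable (fun t => w t - u t) (timeMeasure T)) :
    ∀ᵐ t ∂(timeMeasure T), ∀ v : H10 Ω,
      ⟪toL2 Ω (Ut t) - ut t, toL2 Ω v⟫_ℝ = ⟪toL2 Ω U1 - u1, toL2 Ω v⟫_ℝ -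
        energyFormL a (∫ s in (0 : ℝ)..t, (w s - u s)) v := by
  have : CompleteSpace Vh := FiniteDimensional.complete ℝ Vh
  have hUt : HasTimeDeriv T (fun t => toL2 Ω (Ut t)) (fun t => toL2 Ω (Utt t)) (toL2 Ω U1) :=
    hU.deriv_Ut.clm_comp ((toL2 Ω).comp Vh.subtypeL)
  filter_upwards [hUt.2, hu.deriv_ut.2, ae_restrict_mem measurableSet_Ioo] with t h1 h2 htm v
  have i1 := hUt.1.intervalIntegrable_timeMeasure htm.1.le htm.2.le
  have i2 := hu.deriv_ut.1.intervalIntegrable_timeMeasure htm.1.le htm.2.le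
  have i3 := hρ.intervalIntegrable_timeMeasure htm.1.le htm.2.le
  have e1 : ⟪toL2 Ω (Ut t), toL2 Ω v⟫_ℝ = ⟪toL2 Ω U1, toL2 Ω v⟫_ℝ +
      ∫ s in (0 : ℝ)..t, ⟪toL2 Ω (Utt s), toL2 Ω v⟫_ℝ := by
    have h := congrArg (innerSL ℝ (toL2 Ω v)) h1
    rw [map_add, ← ContinuousLinearMap.intervalIntegral_comp_comm _ i1] at h
    simpa only [innerSL_apply_apply, real_inner_comm (toL2 Ω v)] using h
  have e2 : ⟪ut t, toL2 Ω v⟫_ℝ = ⟪u1, toL2 Ω v⟫_ℝ + ∫ s in (0 : ℝ)..t, utt s v := by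
    have h := congrArg (fun L : Hm1 Ω => L v) h2
    rw [add_apply, ContinuousLinearMap.intervalIntegral_apply i2] at h
    exact h
  have e3 : energyFormL a (∫ s in (0 : ℝ)..t, (w s - u s)) v =
      ∫ s in (0 : ℝ)..t, energyForm a (w s - u s) v := by
    rw [← ContinuousLinearMap.flip_apply,
      ← ContinuousLinearMap.intervalIntegral_comp_comm _ i3]
    rfl
  -- The equations for `u` and for `w` hold with the same test function `v` and the same `f`, so `f`
  -- cancels.
  have e4 : ∫ s in (0 : ℝ)..t, energyForm a (w s - u s) v =
      ∫ s in (0 : ℝ)..t, (utt s v - ⟪toL2 Ω (Utt s), toL2 Ω v⟫_ℝ) := by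
    refine intervalIntegral.integral_congr_ae ?_
    filter_upwards [ae_uIoc_of_ae_timeMeasure htm.1.le htm.2.le hu.equation,
      ae_uIoc_of_ae_timeMeasure htm.1.le htm.2.le (hw.ae_inner_eq hU)] with s h3 h4 hs
    have h3 := h3 hs v
    have h4 := h4 hs v
    rw [map_sub, LinearMap.sub_apply]
    linarith
  have j1 : IntervalIntegrable (fun s => ⟪toL2 Ω (Utt s), toL2 Ω v⟫_ℝ) volume 0 t := by
    refine ⟨?_, ?_⟩
    · exact i1.1.inner_const _
    · exact i1.2.inner_const _
  have j2 : IntervalIntegrable (fun s => utt s v) volume 0 t :=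
    ⟨i2.1.apply_continuousLinearMap v, i2.2.apply_continuousLinearMap v⟩
  rw [intervalIntegral.integral_sub j2 j1] at e4
  rw [inner_sub_left, inner_sub_left]
  linarith

/-- The abstract estimate with `η = e_t`, `ζ = ε_t`, `r0 = e(0) + ε(0)`, `e1 = e_t(0)` and `κ = max
C 0 / αmin`. -/
theorem ae_norm_reconstruction_error_le (hT : 0 ≤ T) (hf : MemLp f 2 (timeMeasure T))
    (hu : IsWaveSolution a T f u0 u1 u ut utt)
    (hU : IsSemidiscreteSolution a T f Vh U0 U1 U Ut Utt)
    (hw : IsEllipticReconstruction a T f Vh U w)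
    (hε : HasTimeDeriv T (fun t => toL2 Ω (w t - U t)) εt ε0)
    {C : ℝ} (hC : IsPoincareConst Ω C) :
    ∀ᵐ t ∂(timeMeasure T), ‖toL2 Ω (w t - u t)‖ ≤
      ‖toL2 Ω U0 - toL2 Ω u0 + ε0‖ + 2 * (∫ t in (0 : ℝ)..T, ‖εt t‖) +
        min (2 * T) √(max C 0 / a.αmin) * ‖toL2 Ω U1 - u1‖ := by
  have : CompleteSpace Vh := FiniteDimensional.complete ℝ Vh
  have hρ : Integrable (fun t => w t - u t) (timeMeasure T) :=
    (hw.integrable hf hC hU.memLp_U).sub (hu.memLp_u.integrable one_le_two)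
  have he : HasTimeDeriv T (fun t => toL2 Ω (U t) - toL2 Ω (u t))
      (fun t => toL2 Ω (Ut t) - ut t) (toL2 Ω U0 - toL2 Ω u0) :=
    (hU.deriv_U.clm_comp ((toL2 Ω).comp Vh.subtypeL)).sub hu.deriv_u
  refine norm_le_of_energy (toL2 Ω) (energyFormL a) (energyForm_symm a)
    (div_nonneg (le_max_right _ _) a.αmin_pos.le) (norm_toL2_sq_le_energyForm a hC)
    (energyForm_self_nonneg a) hT hρ he.1 hε.1 ?_ (ae_inner_error_eq hu hU hw hρ)
  filter_upwards [(he.add hε).2] with t ht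
  rw [← ht, map_sub, map_sub]
  abel

end ErrorBound

end WaveFEM

/-! ### From `w - u` to `U - u`. -/

theorem mainTheorem1 {d : ℕ} (hd : 0 < d)
    (Ω : TopologicalSpace.Opens (EuclideanSpace ℝ (Fin d)))
    (hΩ : Bornology.IsBounded (Ω : Set (EuclideanSpace ℝ (Fin d))))
    (a : WaveFEM.DiffusionCoeff Ω) (T : ℝ) (hT : 0 < T)
    (f : ℝ → WaveFEM.L2 Ω) (hf : MemLp f 2 (WaveFEM.timeMeasure T))
    (u0 : WaveFEM.H10 Ω) (u1 : WaveFEM.L2 Ω)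
    (u : ℝ → WaveFEM.H10 Ω) (ut : ℝ → WaveFEM.L2 Ω) (utt : ℝ → WaveFEM.Hm1 Ω)
    (hu : WaveFEM.IsWaveSolution a T f u0 u1 u ut utt)
    (Vh : Submodule ℝ (WaveFEM.H10 Ω)) [FiniteDimensional ℝ Vh]
    (U0 U1 : Vh) (U Ut Utt : ℝ → Vh)
    (hU : WaveFEM.IsSemidiscreteSolution a T f Vh U0 U1 U Ut Utt)
    (w : ℝ → WaveFEM.H10 Ω) (hw : WaveFEM.IsEllipticReconstruction a T f Vh U w)
    (ε0 : WaveFEM.L2 Ω) (εt : ℝ → WaveFEM.L2 Ω)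
    (hε : WaveFEM.HasTimeDeriv T (fun t => WaveFEM.toL2 Ω (w t - U t)) εt ε0) :
    (∃ C : ℝ, WaveFEM.IsPoincareConst Ω C) ∧
    ∀ C : ℝ, WaveFEM.IsPoincareConst Ω C →
      eLpNorm (fun t => WaveFEM.toL2 Ω (U t - u t)) ∞ (WaveFEM.timeMeasure T) ≤
        eLpNorm (fun t => WaveFEM.toL2 Ω (w t - U t)) ∞ (WaveFEM.timeMeasure T) +
        ENNReal.ofReal
          (√2 * (‖WaveFEM.toL2 Ω (u0 - U0)‖ + ‖ε0‖) +
            2 * (∫ t in (0 : ℝ)..T, ‖εt t‖) +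
            min (2 * T) √(2 * C / a.αmin) * ‖u1 - WaveFEM.toL2 Ω U1‖) := by
  refine ⟨WaveFEM.exists_isPoincareConst hd hΩ, fun C hC => ?_⟩
  have hα := a.αmin_pos
  have hρ := WaveFEM.ae_norm_reconstruction_error_le hT.le hf hu hU hw hε hC
  have mU : AEStronglyMeasurable (fun t => ((U t : Vh) : WaveFEM.H10 Ω)) (WaveFEM.timeMeasure T) :=
    Vh.subtypeL.continuous.comp_aestronglyMeasurable hU.memLp_U.1
  have m1 : AEStronglyMeasurable (fun t => WaveFEM.toL2 Ω (w t - U t)) (WaveFEM.timeMeasure T) :=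
    (WaveFEM.toL2 Ω).continuous.comp_aestronglyMeasurable (hw.aestronglyMeasurable.sub mU)
  have m2 : AEStronglyMeasurable (fun t => WaveFEM.toL2 Ω (w t - u t)) (WaveFEM.timeMeasure T) :=
    (WaveFEM.toL2 Ω).continuous.comp_aestronglyMeasurable
      (hw.aestronglyMeasurable.sub hu.memLp_u.1)
  have hsplit : (fun t => WaveFEM.toL2 Ω (U t - u t)) =
      (fun t => WaveFEM.toL2 Ω (w t - u t)) - fun t => WaveFEM.toL2 Ω (w t - U t) := by
    funext t
    simp only [Pi.sub_apply, map_sub]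
    abel
  rw [hsplit, add_comm]
  refine (eLpNorm_sub_le m2 m1 le_top).trans ?_
  gcongr
  rw [eLpNorm_exponent_top]
  refine eLpNormEssSup_le_of_ae_bound ?_
  filter_upwards [hρ] with t ht
  refine ht.trans ?_
  have h1 : ‖WaveFEM.toL2 Ω U0 - WaveFEM.toL2 Ω u0 + ε0‖ ≤
      √2 * (‖WaveFEM.toL2 Ω (u0 - U0)‖ + ‖ε0‖) := by
    refine (norm_add_le _ _).trans ?_
    rw [norm_sub_rev, ← map_sub]
    exact le_mul_of_one_le_left (by positivity) (Real.one_le_sqrt.2 one_le_two)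
  -- For `C ≤ 0` the left side is `√0 = 0`, and the real square root is never negative.
  have h2 : √(max C 0 / a.αmin) ≤ √(2 * C / a.αmin) := by
    rcases le_total C 0 with h | h
    · simp [max_eq_right h]
    · rw [max_eq_left h]
      gcongr
      linarith
  rw [norm_sub_rev u1]
  gcongr
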